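/- Let $n\ge 0$, $T>0$, and let $f_1:\mathbb R^n\times\mathbb R\to\mathbb R^n$ and $f_3:\mathbb R^n\times\mathbb R\to\mathbb R$ be continuously differentiable and $T$-periodic in the second variable $z$, with $f_1(0,z)=0$ for all $z$ and $f_3(x,z)\ge\vartheta$ for all $(x,z)$, where $\vartheta>0$ is a constant. For $\varepsilon>0$ consider the slow-fast system $$\dot x=f_1(x,z),\qquad \varepsilon\dot z=f_3(x,z),\tag{1}$$ and assume that for all sufficiently small $\varepsilon>0$ the solution of (1) with any initial value $(x(0),z(0))=(x_0,z_0)\in\mathbb R^n\times\mathbb R$ exists for all $t\ge 0$. Put $h_1=f_1/f_3$ and $\hat h_{\rm av}(w)=\frac1T\int_0^T h_1(w,\tau)\,d\tau$. Suppose that: (i) the equilibrium $w=0$ of the averaged system $\frac{dw}{dz}=\varepsilon\,\hat h_{\rm av}(w)$ is exponentially stable (by rescaling $z$, this holds for one $\varepsilon>0$ if and only if it holds for all), i.e. there are $k,\lambda,\delta>0$ such that for every $z_0\in\mathbb{R}$ every solution with $\|w(z_0)\|<\delta$ exists for all $z\ge z_0$ and satisfies $\|w(z)\|\le k\|w(z_0)\|e^{-\lambda(z-z_0)}$;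 (ii) there are $\delta>0$ and $L>0$ such that $\left\|\frac{\partial h_1}{\partial x}(x,z)\right\|\le L$ for all $\|x\|<\delta$ and $z\in\mathbb R$. Then there exists $\varepsilon_1>0$ such that for every $\varepsilon\in(0,\varepsilon_1)$ the partial equilibrium $x=0$ of (1) is exponentially stable uniformly in $z$: there are $c_1,c_2,\delta'>0$ such that for all $z_0\in\mathbb R$ and all $x_0$ with $\|x_0\|<\delta'$ the solution of (1) with $(x(0),z(0))=(x_0,z_0)$ satisfies $\|x(t)\|\le c_1\|x_0\|e^{-c_2t}$ for all $t\ge0$. In particular, if $f_3\equiv1$, then for every $\varepsilon\in(0,\varepsilon_1)$ the equilibrium $x=0$ of the fast time-varying system $\dot x=f_1(x,t/\varepsilon)$ is exponentially stable, uniformly in the initial time (the classical averaging criterion). -/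

import Mathlib

/-- `(x, z)` solves `ẋ = f₁(x, z)`, `ε ż = f₃(x, z)` for all `t ≥ 0`
(at `t = 0` the derivatives are one-sided). -/
structure IsSlowFastSolution {n : ℕ}
    (f₁ : EuclideanSpace ℝ (Fin n) → ℝ → EuclideanSpace ℝ (Fin n))
    (f₃ : EuclideanSpace ℝ (Fin n) → ℝ → ℝ) (ε : ℝ)
    (x : ℝ → EuclideanSpace ℝ (Fin n)) (z : ℝ → ℝ) : Prop where
  slow : ∀ t ∈ Set.Ici (0 : ℝ), HasDerivWithinAt x (f₁ (x t) (z t)) (Set.Ici 0) t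
  fast : ∀ t ∈ Set.Ici (0 : ℝ), HasDerivWithinAt z (f₃ (x t) (z t) / ε) (Set.Ici 0) t

/-- The partial equilibrium `x = 0` of `ẋ = f₁(x, z)`, `ε ż = f₃(x, z)` is exponentially
`x`-stable uniformly in `z`. The solutions starting with `‖x(0)‖ < δ` are also required to exist
for all `t ≥ 0`, so that the estimate is never void. -/
def PartiallyExpStable {n : ℕ}
    (f₁ : EuclideanSpace ℝ (Fin n) → ℝ → EuclideanSpace ℝ (Fin n))
    (f₃ : EuclideanSpace ℝ (Fin n) → ℝ → ℝ) (ε : ℝ) : Prop :=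
  ∃ c₁ > 0, ∃ c₂ > 0, ∃ δ > 0, ∀ (x₀ : EuclideanSpace ℝ (Fin n)) (z₀ : ℝ), ‖x₀‖ < δ →
    (∃ x z, IsSlowFastSolution f₁ f₃ ε x z ∧ x 0 = x₀ ∧ z 0 = z₀) ∧
    ∀ x z, IsSlowFastSolution f₁ f₃ ε x z → x 0 = x₀ → z 0 = z₀ →
      ∀ t ≥ 0, ‖x t‖ ≤ c₁ * ‖x₀‖ * Real.exp (-c₂ * t)

/-- `w` solves `dw/ds = F(s, w)` for all `s ≥ s₀`. -/
def IsSolutionFrom {n : ℕ} (F : ℝ → EuclideanSpace ℝ (Fin n) → EuclideanSpace ℝ (Fin n))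
    (s₀ : ℝ) (w : ℝ → EuclideanSpace ℝ (Fin n)) : Prop :=
  ∀ s ∈ Set.Ici s₀, HasDerivWithinAt w (F s (w s)) (Set.Ici s₀) s

/-- The equilibrium `w = 0` of `dw/ds = F(s, w)` is (locally) exponentially stable, uniformly in
the initial time. The solutions starting in the ball of radius `δ` are also required to exist
for all later times, so that the estimate is never void. -/
def UniformlyExpStable {n : ℕ}
    (F : ℝ → EuclideanSpace ℝ (Fin n) → EuclideanSpace ℝ (Fin n)) : Prop :=
  ∃ k > 0, ∃ c > 0, ∃ δ > 0, ∀ (s₀ : ℝ) (w₀ : EuclideanSpace ℝ (Fin n)), ‖w₀‖ < δ →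
    (∃ w, IsSolutionFrom F s₀ w ∧ w s₀ = w₀) ∧
    ∀ w, IsSolutionFrom F s₀ w → w s₀ = w₀ →
      ∀ s ≥ s₀, ‖w s‖ ≤ k * ‖w₀‖ * Real.exp (-c * (s - s₀))

/-- The quotient `h₁ = f₁ / f₃`, the right-hand side when `z` is used as time. -/
noncomputable def slowField {n : ℕ}
    (f₁ : EuclideanSpace ℝ (Fin n) → ℝ → EuclideanSpace ℝ (Fin n))
    (f₃ : EuclideanSpace ℝ (Fin n) → ℝ → ℝ)
    (x : EuclideanSpace ℝ (Fin n)) (z : ℝ) : EuclideanSpace ℝ (Fin n) :=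
  (f₃ x z)⁻¹ • f₁ x z

/-- The average `(1/T) ∫₀ᵀ h(w, τ) dτ`. -/
noncomputable def averagedField {n : ℕ} (T : ℝ)
    (h : EuclideanSpace ℝ (Fin n) → ℝ → EuclideanSpace ℝ (Fin n))
    (w : EuclideanSpace ℝ (Fin n)) : EuclideanSpace ℝ (Fin n) :=
  (1 / T) • ∫ τ in (0 : ℝ)..T, h w τ

/-! With `z` as the time, the slow equation is `dx/dz = ε h₁(x, z)`. Since `h₁` vanishes at `0` and
is `L`-Lipschitz near it, every error in a ball of radius `r` is proportional to `r`, which is what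
yields exponential rather than merely practical stability.

Put `q = ε T L`. Over one period both `x` and the averaged solution `v` move by `ε T ĥ_av` at their
starting point, up to `O(q² r)` (`norm_increment_sub_integral_le`). A discrete Gronwall argument
over `N ≈ S / q` periods gives `‖x - v‖ = O(q exp(S) r)` (`norm_sub_averaged_le`). Choose `S` so
that `v` shrinks to `r / 4`, then `ε` so small that the error is at most `r / 4`: the bound `r` is
halved over the window (`exists_halving_window`). Iterating gives decay in `z` (`exists_exp_decay`),
and `z` advances at speed at least `ϑ / ε`.

The function `z` is never inverted: each bound is a comparison in `t` whose two sides carry the same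
factor `g`. -/

open Set in
/-- `x` solves `dx/dz = h(x, z)` along the increasing time change `z`, whose speed `g` is at
least `κ`. -/
structure IsReparametrizedSolution {E : Type*} [NormedAddCommGroup E] [NormedSpace ℝ E]
    (h : E → ℝ → E) (κ : ℝ) (g : ℝ → ℝ) (x : ℝ → E) (z : ℝ → ℝ) : Prop where
  pos : 0 < κ
  speed : ∀ t ∈ Ici (0 : ℝ), κ ≤ g t
  time : ∀ t ∈ Ici (0 : ℝ), HasDerivWithinAt z (g t) (Ici 0) t
  state : ∀ t ∈ Ici (0 : ℝ), HasDerivWithinAt x (g t • h (x t) (z t)) (Ici 0) t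

/-- A time-dependent field, continuous in time, which vanishes at `0` and is `ℓ`-Lipschitz on the
ball of radius `δ`. -/
structure IsLipschitzField {E : Type*} [NormedAddCommGroup E]
    (h : E → ℝ → E) (ℓ δ : ℝ) : Prop where
  pos : 0 < ℓ
  cont : ∀ x, Continuous (h x)
  zero : ∀ z, h 0 z = 0
  lip : ∀ x y z, ‖x‖ < δ → ‖y‖ < δ → ‖h x z - h y z‖ ≤ ℓ * ‖x - y‖

/-! ### Estimates along a time change -/

section Reparametrized

variable {E : Type*} [NormedAddCommGroup E] [NormedSpace ℝ E]
  {h : E → ℝ → E} {κ ℓ δ : ℝ} {g z : ℝ → ℝ} {x : ℝ → E}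

theorem IsReparametrizedSolution.mul_sub_le (H : IsReparametrizedSolution h κ g x z)
    {s t : ℝ} (hs : 0 ≤ s) (hst : s ≤ t) : κ * (t - s) ≤ z t - z s := by
  have hd : ∀ u ∈ interior (Set.Ici (0 : ℝ)), HasDerivAt z (g u) u := by
    intro u hu
    rw [interior_Ici, Set.mem_Ioi] at hu
    exact (H.time u hu.le).hasDerivAt (Ici_mem_nhds hu)
  refine (convex_Ici (0 : ℝ)).mul_sub_le_image_sub_of_le_deriv
    (fun u hu => (H.time u hu).continuousWithinAt)
    (fun u hu => (hd u hu).differentiableAt.differentiableWithinAt)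
    (fun u hu => ?_) s hs t (hs.trans hst) hst
  rw [(hd u hu).deriv]
  exact H.speed u (interior_subset hu)

theorem IsReparametrizedSolution.time_le (H : IsReparametrizedSolution h κ g x z)
    {s t : ℝ} (hs : 0 ≤ s) (hst : s ≤ t) : z s ≤ z t := by
  have := H.mul_sub_le hs hst
  have := mul_nonneg H.pos.le (sub_nonneg.2 hst)
  linarith

theorem IsReparametrizedSolution.eq_of_time_eq (H : IsReparametrizedSolution h κ g x z)
    {s t : ℝ} (hs : 0 ≤ s) (hst : s ≤ t) (hz : z t = z s) : t = s := by
  have h1 := H.mul_sub_le hs hst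
  have h2 : κ * (t - s) ≤ κ * 0 := by rw [mul_zero]; linarith
  have := le_of_mul_le_mul_left h2 H.pos
  linarith

theorem IsReparametrizedSolution.exists_time_eq (H : IsReparametrizedSolution h κ g x z)
    {a t c : ℝ} (ha : 0 ≤ a) (hat : a ≤ t) (hc : z a ≤ c) (hct : c ≤ z t) :
    ∃ s, a ≤ s ∧ s ≤ t ∧ z s = c := by
  have hcont : ContinuousOn z (Set.Icc a t) := fun u hu =>
    (H.time u (ha.trans hu.1)).continuousWithinAt.mono fun v hv => ha.trans hv.1
  obtain ⟨s, hs, h⟩ := intermediate_value_Icc hat hcont ⟨hc, hct⟩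
  exact ⟨s, hs.1, hs.2, h⟩

theorem IsLipschitzField.norm_le {E : Type*} [NormedAddCommGroup E] {h : E → ℝ → E} {ℓ δ : ℝ}
    (hh : IsLipschitzField h ℓ δ) {y : E} (hy : ‖y‖ < δ) (s : ℝ) :
    ‖h y s‖ ≤ ℓ * ‖y‖ := by
  have := hh.lip y 0 s hy (by rw [norm_zero]; exact (norm_nonneg y).trans_lt hy)
  rwa [hh.zero, sub_zero, sub_zero] at this

/-- A continuation argument: where the bound is attained, `‖x t‖ ≤ 2 * r`, so the field is at most
`2 * ℓ * r`. The constant 3 makes the derivative comparison strict there. -/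
theorem IsReparametrizedSolution.norm_sub_le (H : IsReparametrizedSolution h κ g x z)
    (hh : IsLipschitzField h ℓ δ) {a b r : ℝ} (ha : 0 ≤ a) (hr : 0 < r)
    (hxa : ‖x a‖ ≤ r) (hrδ : 2 * r < δ) (hp : 3 * ℓ * (z b - z a) ≤ 1) :
    ∀ t ∈ Set.Icc a b, ‖x t - x a‖ ≤ 3 * ℓ * r * (z t - z a) := by
  have hsub : ∀ t, a ≤ t → Set.Ici t ⊆ Set.Ici (0 : ℝ) := fun t ht =>
    Set.Ici_subset_Ici.2 (ha.trans ht)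
  have hℓ := hh.pos
  refine image_norm_le_of_norm_deriv_right_lt_deriv_boundary'
    (f' := fun t => g t • h (x t) (z t)) (B' := fun t => 3 * ℓ * r * g t) ?_ ?_ ?_ ?_ ?_ ?_
  · exact fun t ht => ((H.state t (ha.trans ht.1)).continuousWithinAt.mono
      fun v hv => ha.trans hv.1).sub continuousWithinAt_const
  · exact fun t ht => ((H.state t (ha.trans ht.1)).mono (hsub t ht.1)).sub_const _
  · simp
  · exact fun t ht => ((((H.time t (ha.trans ht.1)).continuousWithinAt.mono
      fun v hv => ha.trans hv.1).sub continuousWithinAt_const)).const_mul _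
  · exact fun t ht => (((H.time t (ha.trans ht.1)).mono (hsub t ht.1)).sub_const _).const_mul _
  · intro t ht heq
    have h0 : 0 ≤ t := ha.trans ht.1
    have hg : 0 < g t := H.pos.trans_le (H.speed t h0)
    have hzb := H.time_le h0 ht.2.le
    have hle : ‖x t - x a‖ ≤ r := by
      rw [heq]
      calc 3 * ℓ * r * (z t - z a) = r * (3 * ℓ * (z t - z a)) := by ring
        _ ≤ r * 1 := by
          refine mul_le_mul_of_nonneg_left (le_trans ?_ hp) hr.le
          gcongr
        _ = r := mul_one r
    have hxt : ‖x t‖ ≤ 2 * r := by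
      have := norm_le_norm_add_norm_sub' (x t) (x a)
      linarith
    have hn := hh.norm_le (hxt.trans_lt hrδ) (z t)
    rw [norm_smul, Real.norm_of_nonneg hg.le]
    calc g t * ‖h (x t) (z t)‖ ≤ g t * (ℓ * (2 * r)) := by
          refine mul_le_mul_of_nonneg_left (hn.trans ?_) hg.le
          gcongr
      _ < 3 * ℓ * r * g t := by
          have : 0 < g t * ℓ * r := by positivity
          nlinarith

theorem IsReparametrizedSolution.norm_le_two_mul (H : IsReparametrizedSolution h κ g x z)
    (hh : IsLipschitzField h ℓ δ) {a b r : ℝ} (ha : 0 ≤ a) (hr : 0 < r) (hab : a ≤ b)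
    (hxa : ‖x a‖ ≤ r) (hrδ : 2 * r < δ) (hp : 3 * ℓ * (z b - z a) ≤ 1) : ‖x b‖ ≤ 2 * r := by
  have h1 := H.norm_sub_le hh ha hr hxa hrδ hp b ⟨hab, le_rfl⟩
  have h2 := norm_le_norm_add_norm_sub' (x b) (x a)
  nlinarith

/-- Over a short stretch of `z`, the increment of a solution is the integral of the field at the
frozen initial state, up to second order. -/
theorem IsReparametrizedSolution.norm_increment_sub_integral_le [CompleteSpace E]
    (H : IsReparametrizedSolution h κ g x z)
    (hh : IsLipschitzField h ℓ δ) {a b r : ℝ} (ha : 0 ≤ a) (hr : 0 < r) (hab : a ≤ b)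
    (hxa : ‖x a‖ ≤ r) (hrδ : 2 * r < δ) (hp : 3 * ℓ * (z b - z a) ≤ 1) :
    ‖x b - x a - ∫ s in z a..z b, h (x a) s‖ ≤ 3 * (ℓ * (z b - z a)) ^ 2 * r := by
  have hsub : ∀ t, a ≤ t → Set.Ici t ⊆ Set.Ici (0 : ℝ) := fun t ht =>
    Set.Ici_subset_Ici.2 (ha.trans ht)
  have hℓ := hh.pos
  have hnear := H.norm_sub_le hh ha hr hxa hrδ hp
  set p := z b - z a with hpdef
  have hint : ∀ s, HasDerivAt (fun s => ∫ u in z a..s, h (x a) u) (h (x a) s) s := fun s =>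
    ((hh.cont (x a)).integral_hasStrictDerivAt (z a) s).hasDerivAt
  have hder : ∀ t ∈ Set.Ici (0 : ℝ), HasDerivWithinAt
      (fun t => x t - x a - ∫ u in z a..z t, h (x a) u)
      (g t • h (x t) (z t) - g t • h (x a) (z t)) (Set.Ici 0) t := fun t ht =>
    ((H.state t ht).sub_const _).sub ((hint (z t)).scomp_hasDerivWithinAt t (H.time t ht))
  -- The derivative of the defect is `g` times the change of the field from `x a` to `x t`, and that
  -- displacement is at most `3 * ℓ * r * p`.
  have key := image_norm_le_of_norm_deriv_right_le_deriv_boundary' (a := a) (b := b)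
    (f := fun t => x t - x a - ∫ u in z a..z t, h (x a) u)
    (f' := fun t => g t • h (x t) (z t) - g t • h (x a) (z t))
    (B := fun t => 3 * ℓ ^ 2 * r * p * (z t - z a)) (B' := fun t => 3 * ℓ ^ 2 * r * p * g t)
    (fun t ht => (hder t (ha.trans ht.1)).continuousWithinAt.mono fun v hv => ha.trans hv.1)
    (fun t ht => (hder t (ha.trans ht.1)).mono (hsub t ht.1))
    (by simp)
    (fun t ht => (((H.time t (ha.trans ht.1)).continuousWithinAt.mono
      fun v hv => ha.trans hv.1).sub continuousWithinAt_const).const_mul _)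
    (fun t ht => (((H.time t (ha.trans ht.1)).mono (hsub t ht.1)).sub_const _).const_mul _)
    (by
      intro t ht
      have h0 : 0 ≤ t := ha.trans ht.1
      have hg : 0 < g t := H.pos.trans_le (H.speed t h0)
      have hzb := H.time_le h0 ht.2.le
      have hd : ‖x t - x a‖ ≤ 3 * ℓ * r * p := (hnear t ⟨ht.1, ht.2.le⟩).trans (by
        rw [hpdef]; gcongr)
      have hd' : ‖x t - x a‖ ≤ r := hd.trans (by nlinarith)
      have hxt : ‖x t‖ ≤ 2 * r := by
        have := norm_le_norm_add_norm_sub' (x t) (x a)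
        linarith
      rw [← smul_sub, norm_smul, Real.norm_of_nonneg hg.le]
      calc g t * ‖h (x t) (z t) - h (x a) (z t)‖ ≤ g t * (ℓ * (3 * ℓ * r * p)) := by
            refine mul_le_mul_of_nonneg_left ?_ hg.le
            exact (hh.lip _ _ _ (hxt.trans_lt hrδ) (by linarith)).trans (by gcongr)
        _ = 3 * ℓ ^ 2 * r * p * g t := by ring)
  calc _ ≤ 3 * ℓ ^ 2 * r * p * (z b - z a) := key ⟨hab, le_rfl⟩
    _ = _ := by rw [← hpdef]; ring

end Reparametrized

/-! ### Comparison with the averaged system over periods -/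

section Averaging

variable {n : ℕ} {h : EuclideanSpace ℝ (Fin n) → ℝ → EuclideanSpace ℝ (Fin n)} {L δ T : ℝ}

theorem IsLipschitzField.const_smul (hh : IsLipschitzField h L δ) {ε : ℝ} (hε : 0 < ε) :
    IsLipschitzField (fun x z => ε • h x z) (ε * L) δ where
  pos := mul_pos hε hh.pos
  cont x := (hh.cont x).const_smul ε
  zero z := by rw [hh.zero, smul_zero]
  lip x y z hx hy := by
    rw [← smul_sub, norm_smul, Real.norm_of_nonneg hε.le, mul_assoc]
    exact mul_le_mul_of_nonneg_left (hh.lip x y z hx hy) hε.le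

theorem IsLipschitzField.averagedField (hh : IsLipschitzField h L δ) (hT : 0 < T) :
    IsLipschitzField (fun x _ => averagedField T h x) L δ where
  pos := hh.pos
  cont _ := continuous_const
  zero _ := by simp [_root_.averagedField, hh.zero]
  lip x y _ hx hy := by
    have hi : ∀ w, IntervalIntegrable (h w) MeasureTheory.volume 0 T := fun w =>
      (hh.cont w).intervalIntegrable _ _
    have hb := intervalIntegral.norm_integral_le_of_norm_le_const
      (a := 0) (b := T) (f := fun τ => h x τ - h y τ) (fun τ _ => hh.lip x y τ hx hy)
    rw [intervalIntegral.integral_sub (hi x) (hi y), sub_zero, abs_of_pos hT] at hb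
    rw [_root_.averagedField, _root_.averagedField, ← smul_sub, norm_smul,
      Real.norm_of_nonneg (by positivity)]
    calc _ ≤ 1 / T * (L * ‖x - y‖ * T) := by gcongr
      _ = L * ‖x - y‖ := by field_simp

theorem integral_period_eq_averagedField (hT : 0 < T) (hper : ∀ x z, h x (z + T) = h x z)
    (ε : ℝ) (x : EuclideanSpace ℝ (Fin n)) (s : ℝ) :
    ∫ τ in s..s + T, ε • h x τ = (ε * T) • averagedField T h x := by
  have hp : Function.Periodic (h x) T := hper x
  rw [intervalIntegral.integral_smul, hp.intervalIntegral_add_eq s 0, zero_add, averagedField,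
    smul_smul]
  congr 1
  field_simp

variable {κ : ℝ} {g z : ℝ → ℝ} {x v : ℝ → EuclideanSpace ℝ (Fin n)}

/-- Finite-horizon averaging estimate, sampled at whole periods. -/
theorem norm_sub_averaged_le (hT : 0 < T) (hh : IsLipschitzField h L δ)
    (hper : ∀ x z, h x (z + T) = h x z) {ε ε' : ℝ} (hε : 0 < ε) (hε' : 0 < ε')
    (H : IsReparametrizedSolution (fun x z => ε • h x z) κ g x z)
    (V : IsReparametrizedSolution (fun x _ => ε' • averagedField T h x) 1 (fun _ => 1) v id)
    {a r K : ℝ} (ha : 0 ≤ a) (hr : 0 < r) (hK : 0 < K) (hva : v 0 = x a)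
    (hv : ∀ s, 0 ≤ s → ‖v s‖ ≤ K * r) (hrδ : 2 * ((K + 1) * r) < δ)
    (hq : 3 * (ε * T * L) ≤ 1) {N : ℕ}
    (hN : 6 * (ε * T * L) * (K + 1) * (1 + ε * T * L) ^ N ≤ 1 / 4) :
    ∀ j ≤ N, ∀ t, a ≤ t → z t = z a + j * T →
      ‖x t - v (j * (ε * T / ε'))‖ ≤
        6 * (ε * T * L) * (K + 1) * r * ((1 + ε * T * L) ^ j - 1) := by
  have hL := hh.pos
  -- One period of `x` corresponds to time `η` of `v`; `q` is the Lipschitz constant times elapsed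
  -- time for both. The two one-period defects, `3 * q ^ 2 * R` each, give `e (j+1) ≤ (1 + q) * e j
  -- + 6 * q ^ 2 * R`.
  set q := ε * T * L with hqdef
  have hq0 : 0 < q := by positivity
  set R := (K + 1) * r with hR
  have hR0 : 0 < R := by positivity
  set η := ε * T / ε' with hη
  have hη0 : 0 < η := by positivity
  have hqη : ε' * L * η = q := by rw [hη, hqdef]; field_simp
  intro j
  induction j with
  | zero =>
    intro _ t hat hzt
    have : t = a := H.eq_of_time_eq ha hat (by simpa using hzt)
    simp [this, hva]
  | succ j ih =>
    intro hj t hat hzt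
    push_cast at hzt ⊢
    obtain ⟨s, has, hst, hzs⟩ := H.exists_time_eq ha hat (c := z a + j * T)
      (le_add_of_nonneg_right (by positivity)) (by rw [hzt]; nlinarith)
    have hd := ih (by omega) s has hzs
    have hpow : (1 + q) ^ j ≤ (1 + q) ^ N := pow_le_pow_right₀ (by linarith) (by omega)
    -- The error bound keeps `x s` in the ball of radius `R`, so the one-period estimate applies
    -- again.
    have hdr : ‖x s - v (j * η)‖ ≤ r := by
      refine hd.trans ?_
      calc 6 * q * (K + 1) * r * ((1 + q) ^ j - 1)
          ≤ 6 * q * (K + 1) * r * (1 + q) ^ N := by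
            refine mul_le_mul_of_nonneg_left (by linarith) (by positivity)
        _ = r * (6 * q * (K + 1) * (1 + q) ^ N) := by ring
        _ ≤ r * (1 / 4) := mul_le_mul_of_nonneg_left hN hr.le
        _ ≤ r := by linarith
    have hσ : 0 ≤ j * η := by positivity
    have hvj : ‖v (j * η)‖ ≤ R := (hv _ hσ).trans (by rw [hR]; nlinarith)
    have hxs : ‖x s‖ ≤ R := by
      have h1 := norm_le_norm_add_norm_sub' (x s) (v (j * η))
      have h2 := hv _ hσ
      rw [hR]; linarith
    have hzts : z t = z s + T := by rw [hzt, hzs]; ring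
    have hx1 := H.norm_increment_sub_integral_le (hh.const_smul hε) (ha.trans has) hR0 hst hxs hrδ
      (by rw [hzts, hqdef] at *; linarith)
    rw [hzts, integral_period_eq_averagedField hT hper, add_sub_cancel_left] at hx1
    have hv1 := V.norm_increment_sub_integral_le ((hh.averagedField hT).const_smul hε')
      (a := j * η) (b := (j + 1) * η) hσ hR0 (by nlinarith) hvj hrδ
      (by simp only [id]; nlinarith)
    have e1 : (j + 1) * η - j * η = η := by ring
    simp only [id, intervalIntegral.integral_const, e1, hqη, smul_smul] at hv1
    have e2 : η * ε' = ε * T := by rw [hη]; field_simp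
    have e3 : ε * L * T = q := by rw [hqdef]; ring
    rw [e2] at hv1
    rw [e3] at hx1
    have hA := (hh.averagedField hT).lip (x s) (v (j * η)) 0 (by linarith) (by linarith)
    have hεA : ‖(ε * T) • averagedField T h (x s) - (ε * T) • averagedField T h (v (j * η))‖
        ≤ q * ‖x s - v (j * η)‖ := by
      rw [← smul_sub, norm_smul, Real.norm_of_nonneg (by positivity), hqdef, mul_assoc (ε * T)]
      exact mul_le_mul_of_nonneg_left hA (by positivity)
    have htri : ‖x t - v ((j + 1) * η)‖ ≤ ‖x s - v (j * η)‖
        + ‖(ε * T) • averagedField T h (x s) - (ε * T) • averagedField T h (v (j * η))‖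
        + ‖x t - x s - (ε * T) • averagedField T h (x s)‖
        + ‖v ((j + 1) * η) - v (j * η) - (ε * T) • averagedField T h (v (j * η))‖ := by
      refine le_trans (le_of_eq ?_) ((norm_sub_le _ _).trans (add_le_add_left norm_add₃_le _))
      congr 1; abel
    have hfin : (1 + q) * ‖x s - v (j * η)‖ ≤
        (1 + q) * (6 * q * (K + 1) * r * ((1 + q) ^ j - 1)) :=
      mul_le_mul_of_nonneg_left hd (by positivity)
    calc _ ≤ (1 + q) * ‖x s - v (j * η)‖ + 6 * q ^ 2 * R := by linarith
      _ ≤ (1 + q) * (6 * q * (K + 1) * r * ((1 + q) ^ j - 1)) + 6 * q ^ 2 * R := by linarith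
      _ = _ := by rw [hR, pow_succ]; ring

end Averaging
-- From finite-horizon averaging to exponential decay in `z`
section Averaging

variable {n : ℕ} {h : EuclideanSpace ℝ (Fin n) → ℝ → EuclideanSpace ℝ (Fin n)} {L δ T : ℝ}

/-- If the averaged system is exponentially stable, then for small `ε` the solutions of
`dx/dz = ε h(x, z)` are halved over some whole number of periods. -/
theorem exists_halving_window (hT : 0 < T) (hδ : 0 < δ) (hh : IsLipschitzField h L δ)
    (hper : ∀ x z, h x (z + T) = h x z)
    (hav : ∃ ε > (0 : ℝ), UniformlyExpStable (fun _ w => ε • averagedField T h w)) :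
    ∃ ε₁ > (0 : ℝ), ∃ ρ > (0 : ℝ), ∃ M > (0 : ℝ), ∀ ε : ℝ, 0 < ε → ε < ε₁ → ∃ P > (0 : ℝ), ∀ κ g x z,
      IsReparametrizedSolution (fun x z => ε • h x z) κ g x z →
      ∀ a r, 0 ≤ a → 0 < r → r ≤ ρ → ‖x a‖ ≤ r →
        (∀ t, a ≤ t → z t = z a + P → ‖x t‖ ≤ r / 2) ∧
        ∀ t, a ≤ t → z t ≤ z a + P → ‖x t‖ ≤ M * r := by
  obtain ⟨ε', hε', k, hk, c, hc, δ', hδ', hstab⟩ := hav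
  have hL := hh.pos
  -- Once `N * q ≥ S`, the decay exponent of `v` is at least `4 * k`, and `k * exp (-4 * k) ≤ 1 /
  -- 4`. Also `N * q ≤ S + 1`, so `D` bounds the Gronwall factor independently of `ε`.
  set S := L * ε' / c * (4 * k) with hS
  have hS0 : 0 < S := by positivity
  set D := 24 * (k + 1) * Real.exp (S + 1) with hD
  have hD0 : 0 < D := by positivity
  have hD3 : 3 ≤ D := by
    have h1 : 1 ≤ Real.exp (S + 1) := Real.one_le_exp (by positivity)
    nlinarith
  refine ⟨1 / (T * L * D), by positivity, min (δ / (4 * (k + 1))) (δ' / 2), by positivity,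
    -- `(k + 1) * r` holds at whole periods; the 2 covers the remaining part of a period.
    2 * (k + 1), by positivity, fun ε hε hε1 => ?_⟩
  set q := ε * T * L with hq
  have hq0 : 0 < q := by positivity
  have hqD : q * D ≤ 1 := by
    rw [lt_div_iff₀ (by positivity)] at hε1
    rw [hq]; linarith
  have hq3 : 3 * q ≤ 1 := by nlinarith
  set N := ⌈S / q⌉₊ with hNdef
  have hNpos : 0 < N := Nat.ceil_pos.2 (by positivity)
  have hNS : S ≤ N * q := (div_le_iff₀ hq0).1 (Nat.le_ceil _)
  have hNS' : N * q ≤ S + 1 := by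
    have h1 := (Nat.ceil_lt_add_one (div_pos hS0 hq0).le).le
    have h2 : (N : ℝ) * q ≤ (S / q + 1) * q := mul_le_mul_of_nonneg_right h1 hq0.le
    rw [add_mul, div_mul_cancel₀ _ hq0.ne'] at h2
    linarith
  have hpowN : (1 + q) ^ N ≤ Real.exp (S + 1) := by
    calc (1 + q) ^ N ≤ Real.exp q ^ N := by
          refine pow_le_pow_left₀ (by positivity) ?_ _
          rw [add_comm]; exact Real.add_one_le_exp q
      _ = Real.exp (N * q) := (Real.exp_nat_mul q N).symm
      _ ≤ _ := Real.exp_le_exp.2 hNS'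
  have hNsmall : 6 * q * (k + 1) * (1 + q) ^ N ≤ 1 / 4 := by
    calc 6 * q * (k + 1) * (1 + q) ^ N ≤ 6 * q * (k + 1) * Real.exp (S + 1) := by gcongr
      _ = q * D / 4 := by rw [hD]; ring
      _ ≤ 1 / 4 := by linarith
  refine ⟨N * T, by positivity, fun κ g x z H a r ha hr hrρ hxa => ?_⟩
  have hr1 : r ≤ δ / (4 * (k + 1)) := hrρ.trans (min_le_left _ _)
  have hr2 : r ≤ δ' / 2 := hrρ.trans (min_le_right _ _)
  have hrδ : 2 * ((k + 1) * r) < δ := by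
    rw [le_div_iff₀ (by positivity)] at hr1
    linarith
  obtain ⟨⟨v, hvsol, hva⟩, hvdecay⟩ := hstab 0 (x a) (by linarith)
  have V : IsReparametrizedSolution (fun x _ => ε' • averagedField T h x) 1 (fun _ => 1) v id :=
    ⟨one_pos, fun _ _ => le_rfl, fun t _ => hasDerivWithinAt_id t _,
      fun t ht => by simpa using hvsol t ht⟩
  have hv : ∀ s, 0 ≤ s → ‖v s‖ ≤ k * r * Real.exp (-c * s) := fun s hs => by
    have h1 := hvdecay v hvsol hva s hs
    rw [sub_zero] at h1
    exact h1.trans (by gcongr)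
  have hv' : ∀ s, 0 ≤ s → ‖v s‖ ≤ k * r := fun s hs => (hv s hs).trans <| by
    refine mul_le_of_le_one_right (by positivity) (Real.exp_le_one_iff.2 ?_)
    nlinarith
  have hclose : ∀ j ≤ N, ∀ t, a ≤ t → z t = z a + j * T →
      ‖x t - v (j * (ε * T / ε'))‖ ≤ r / 4 := fun j hj t hat hzt => by
    refine (norm_sub_averaged_le hT hh hper hε hε' H V ha hr hk hva hv' hrδ hq3 hNsmall
      j hj t hat hzt).trans ?_
    have hpow : (1 + q) ^ j ≤ (1 + q) ^ N := pow_le_pow_right₀ (by linarith) hj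
    calc 6 * q * (k + 1) * r * ((1 + q) ^ j - 1) ≤ 6 * q * (k + 1) * r * (1 + q) ^ N :=
          mul_le_mul_of_nonneg_left (by linarith) (by positivity)
      _ = r * (6 * q * (k + 1) * (1 + q) ^ N) := by ring
      _ ≤ r * (1 / 4) := mul_le_mul_of_nonneg_left hNsmall hr.le
      _ = r / 4 := by ring
  constructor
  · intro t hat hzt
    have h1 := hclose N le_rfl t hat hzt
    have h2 := hv (N * (ε * T / ε')) (by positivity)
    have h3 : 4 * k ≤ c * (N * (ε * T / ε')) := by
      have e : c * (N * (ε * T / ε')) = N * q * (c / (L * ε')) := by rw [hq]; field_simp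
      rw [e]
      calc 4 * k = S * (c / (L * ε')) := by rw [hS]; field_simp
        _ ≤ _ := mul_le_mul_of_nonneg_right hNS (by positivity)
    have h4 : k * Real.exp (-c * (N * (ε * T / ε'))) ≤ 1 / 4 := by
      have h5 : 4 * k ≤ Real.exp (c * (N * (ε * T / ε'))) := by
        have := Real.add_one_le_exp (c * (N * (ε * T / ε')))
        linarith
      rw [neg_mul, Real.exp_neg, ← div_eq_mul_inv, div_le_iff₀ (Real.exp_pos _)]
      linarith
    have h6 := norm_le_norm_add_norm_sub' (x t) (v (N * (ε * T / ε')))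
    nlinarith
  · intro t hat hzt
    have hza := H.time_le ha hat
    set j := ⌊(z t - z a) / T⌋₊ with hj
    have h0 : 0 ≤ (z t - z a) / T := div_nonneg (by linarith) hT.le
    have hj1 : j * T ≤ z t - z a := (le_div_iff₀ hT).1 (Nat.floor_le h0)
    have hj2 : z t - z a < (j + 1) * T := (div_lt_iff₀ hT).1 (Nat.lt_floor_add_one _)
    have hjN : j ≤ N := by
      have h1 : (j : ℝ) * T ≤ N * T := by linarith
      exact_mod_cast le_of_mul_le_mul_right h1 hT
    have hjT : (0 : ℝ) ≤ j * T := by positivity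
    obtain ⟨s, has, hst, hzs⟩ := H.exists_time_eq ha hat (c := z a + j * T)
      (by linarith) (by linarith)
    have h1 := hclose j hjN s has hzs
    have h2 := hv' (j * (ε * T / ε')) (by positivity)
    have h6 := norm_le_norm_add_norm_sub' (x s) (v (j * (ε * T / ε')))
    have hxs : ‖x s‖ ≤ (k + 1) * r := by linarith
    have h7 : 3 * (ε * L) * (z t - z s) ≤ 1 := by
      calc 3 * (ε * L) * (z t - z s) ≤ 3 * (ε * L) * T := by
            refine mul_le_mul_of_nonneg_left (by linarith) (by positivity)
        _ = 3 * q := by rw [hq]; ring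
        _ ≤ 1 := hq3
    have h8 := H.norm_le_two_mul (hh.const_smul hε) (ha.trans has) (by positivity) hst hxs hrδ h7
    linarith

/-- Exponential decay in the variable `z`. -/
theorem exists_exp_decay (hT : 0 < T) (hδ : 0 < δ) (hh : IsLipschitzField h L δ)
    (hper : ∀ x z, h x (z + T) = h x z)
    (hav : ∃ ε > (0 : ℝ), UniformlyExpStable (fun _ w => ε • averagedField T h w)) :
    ∃ ε₁ > (0 : ℝ), ∃ ρ > (0 : ℝ), ∃ M > (0 : ℝ), ∀ ε : ℝ, 0 < ε → ε < ε₁ → ∃ μ > (0 : ℝ), ∀ κ g x z,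
      IsReparametrizedSolution (fun x z => ε • h x z) κ g x z → ‖x 0‖ < ρ →
        ∀ t, 0 ≤ t → ‖x t‖ ≤ M * ‖x 0‖ * Real.exp (-μ * (z t - z 0)) := by
  obtain ⟨ε₁, hε₁, ρ, hρ, M, hM, hwin⟩ := exists_halving_window hT hδ hh hper hav
  refine ⟨ε₁, hε₁, ρ, hρ, 2 * M, by positivity, fun ε hε hεε₁ => ?_⟩
  obtain ⟨P, hP, hwin⟩ := hwin ε hε hεε₁
  have hlog : 0 < Real.log 2 := Real.log_pos one_lt_two
  -- One halving per length `P` gives this rate; the last incomplete window costs the 2 in `2 * M`.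
  refine ⟨Real.log 2 / P, by positivity, fun κ g x z H hx0 t ht => ?_⟩
  have hhalf : ∀ r, 0 < r → r ≤ ρ → ‖x 0‖ ≤ r → ∀ m : ℕ, ∀ t, 0 ≤ t → z t = z 0 + m * P →
      ‖x t‖ ≤ r / 2 ^ m := by
    intro r hr hrρ hxr m
    induction m with
    | zero =>
      intro t ht hzt
      have : t = 0 := H.eq_of_time_eq le_rfl ht (by simpa using hzt)
      simpa [this] using hxr
    | succ m ih =>
      intro t ht hzt
      push_cast at hzt
      obtain ⟨s, hs, hst, hzs⟩ := H.exists_time_eq le_rfl ht (c := z 0 + m * P)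
        (le_add_of_nonneg_right (by positivity)) (by rw [hzt]; nlinarith)
      have hle : r / 2 ^ m ≤ r := div_le_self hr.le (one_le_pow₀ one_le_two)
      have := (hwin κ g x z H s (r / 2 ^ m) hs (by positivity) (hle.trans hrρ)
        (ih s hs hzs)).1 t hst (by rw [hzt, hzs]; ring)
      rwa [pow_succ, ← div_div]
  have hbound : ∀ r, 0 < r → r ≤ ρ → ‖x 0‖ ≤ r →
      ‖x t‖ ≤ 2 * M * r * Real.exp (-(Real.log 2 / P) * (z t - z 0)) := by
    intro r hr hrρ hxr
    have hz0 := H.time_le le_rfl ht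
    set m := ⌊(z t - z 0) / P⌋₊ with hm
    have h0 : 0 ≤ (z t - z 0) / P := div_nonneg (by linarith) hP.le
    have hm1 : m * P ≤ z t - z 0 := (le_div_iff₀ hP).1 (Nat.floor_le h0)
    have hm2 : (z t - z 0) / P ≤ m + 1 := (Nat.lt_floor_add_one _).le
    have hm3 : z t - z 0 ≤ (m + 1) * P := (div_le_iff₀ hP).1 hm2
    have hmP : (0 : ℝ) ≤ m * P := by positivity
    obtain ⟨s, hs, hst, hzs⟩ := H.exists_time_eq le_rfl ht (c := z 0 + m * P)
      (by linarith) (by linarith)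
    have hle : r / 2 ^ m ≤ r := div_le_self hr.le (one_le_pow₀ one_le_two)
    have h1 := (hwin κ g x z H s (r / 2 ^ m) hs (by positivity) (hle.trans hrρ)
      (hhalf r hr hrρ hxr m s hs hzs)).2 t hst (by linarith)
    have h2 : ((2 : ℝ) ^ m)⁻¹ ≤ 2 * Real.exp (-(Real.log 2 / P) * (z t - z 0)) := by
      have e1 : (2 : ℝ) ^ (m + 1) = Real.exp ((m + 1 : ℕ) * Real.log 2) := by
        rw [Real.exp_nat_mul, Real.exp_log two_pos]
      have e2 : ((2 : ℝ) ^ m)⁻¹ = 2 * ((2 : ℝ) ^ (m + 1))⁻¹ := by rw [pow_succ]; field_simp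
      rw [e2, e1, ← Real.exp_neg]
      refine mul_le_mul_of_nonneg_left (Real.exp_le_exp.2 ?_) two_pos.le
      have e3 : -(Real.log 2 / P) * (z t - z 0) = -((z t - z 0) / P * Real.log 2) := by ring
      rw [e3]
      push_cast
      exact neg_le_neg (mul_le_mul_of_nonneg_right hm2 hlog.le)
    calc ‖x t‖ ≤ M * (r / 2 ^ m) := h1
      _ = M * r * ((2 : ℝ) ^ m)⁻¹ := by ring
      _ ≤ M * r * (2 * Real.exp (-(Real.log 2 / P) * (z t - z 0))) := by gcongr
      _ = _ := by ring
  -- The window estimate needs `r > 0`; letting `r` decrease to `‖x 0‖` includes the case `x 0 = 0`.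
  have hlim : Filter.Tendsto
      (fun r => 2 * M * r * Real.exp (-(Real.log 2 / P) * (z t - z 0)))
      (nhdsWithin ‖x 0‖ (Set.Ioi ‖x 0‖))
      (nhds (2 * M * ‖x 0‖ * Real.exp (-(Real.log 2 / P) * (z t - z 0)))) :=
    (Continuous.tendsto (by fun_prop) _).mono_left nhdsWithin_le_nhds
  refine ge_of_tendsto hlim ?_
  filter_upwards [Ioc_mem_nhdsGT hx0] with r hr
  exact hbound r ((norm_nonneg _).trans_lt hr.1) hr.2 hr.1.le

end Averaging

/-! ### Return to the slow-fast system -/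

section SlowFast

variable {n : ℕ} {f₁ : EuclideanSpace ℝ (Fin n) → ℝ → EuclideanSpace ℝ (Fin n)}
  {f₃ : EuclideanSpace ℝ (Fin n) → ℝ → ℝ} {ε ϑ : ℝ}

theorem isLipschitzField_slowField {δ L : ℝ}
    (hf₁ : ContDiff ℝ 1 (fun p : EuclideanSpace ℝ (Fin n) × ℝ => f₁ p.1 p.2))
    (hf₃ : ContDiff ℝ 1 (fun p : EuclideanSpace ℝ (Fin n) × ℝ => f₃ p.1 p.2))
    (hzero : ∀ z, f₁ 0 z = 0) (hne : ∀ x z, f₃ x z ≠ 0) (hL : 0 < L)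
    (hbound : ∀ x ∈ Metric.ball (0 : EuclideanSpace ℝ (Fin n)) δ, ∀ z,
      ‖fderiv ℝ (fun x' => slowField f₁ f₃ x' z) x‖ ≤ L) :
    IsLipschitzField (slowField f₁ f₃) L δ := by
  have hs : ContDiff ℝ 1
      (fun p : EuclideanSpace ℝ (Fin n) × ℝ => slowField f₁ f₃ p.1 p.2) :=
    (hf₃.inv fun p => hne p.1 p.2).smul hf₁
  refine ⟨hL, fun x => ?_, fun z => by simp [slowField, hzero], fun x y z hx hy => ?_⟩
  · exact hs.continuous.comp (Continuous.prodMk_right x)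
  · have hd : Differentiable ℝ (fun x' => slowField f₁ f₃ x' z) :=
      (hs.comp (contDiff_prodMk_left z)).differentiable one_ne_zero
    exact (convex_ball 0 δ).norm_image_sub_le_of_norm_fderiv_le (fun w _ => hd w)
      (fun w hw => hbound w hw z) (mem_ball_zero_iff.2 hy) (mem_ball_zero_iff.2 hx)

theorem IsSlowFastSolution.isReparametrizedSolution {x : ℝ → EuclideanSpace ℝ (Fin n)}
    {z : ℝ → ℝ} (H : IsSlowFastSolution f₁ f₃ ε x z) (hε : 0 < ε) (hϑ : 0 < ϑ)
    (hlower : ∀ x z, ϑ ≤ f₃ x z) :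
    IsReparametrizedSolution (fun x z => ε • slowField f₁ f₃ x z) (ϑ / ε)
      (fun t => f₃ (x t) (z t) / ε) x z where
  pos := by positivity
  speed t _ := by have := hlower (x t) (z t); gcongr
  time := H.fast
  state t ht := by
    have h3 : f₃ (x t) (z t) ≠ 0 := (hϑ.trans_le (hlower _ _)).ne'
    refine (H.slow t ht).congr_deriv ?_
    dsimp only [slowField]
    rw [smul_smul, smul_smul]
    have e : f₃ (x t) (z t) / ε * ε * (f₃ (x t) (z t))⁻¹ = 1 := by field_simp
    rw [e, one_smul]

/-- When `f₃ ≡ 1`, partial stability of the slow-fast system is stability of `ẋ = f₁(x, t/ε)`. -/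
theorem PartiallyExpStable.uniformlyExpStable (hone : ∀ x z, f₃ x z = 1)
    (H : PartiallyExpStable f₁ f₃ ε) : UniformlyExpStable (fun t x => f₁ x (t / ε)) := by
  obtain ⟨c₁, hc₁, c₂, hc₂, δ, hδ, H⟩ := H
  refine ⟨c₁, hc₁, c₂, hc₂, δ, hδ, fun s₀ w₀ hw₀ => ?_⟩
  obtain ⟨⟨x, z, hsol, hx0, hz0⟩, hdecay⟩ := H w₀ (s₀ / ε) hw₀
  refine ⟨⟨fun s => x (s - s₀), fun s hs => ?_, by simpa using hx0⟩, fun w hw hw0 s hs => ?_⟩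
  -- For `f₃ ≡ 1` the fast variable is determined, so `x` shifted by `s₀` solves the time-varying
  -- equation.
  · have hz : ∀ t, 0 ≤ t → z t = (s₀ + t) / ε := by
      intro t ht
      have hd : ∀ u ∈ Set.Ici (0 : ℝ),
          HasDerivWithinAt (fun u => z u - (s₀ + u) / ε) 0 (Set.Ici 0) u := fun u hu => by
        have h1 := (hsol.fast u hu).sub
          (((hasDerivWithinAt_id u (Set.Ici 0)).const_add s₀).div_const ε)
        refine h1.congr_deriv ?_
        rw [hone, sub_self]
      have h2 := constant_of_has_deriv_right_zero (a := 0) (b := t)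
        (fun u hu => (hd u hu.1).continuousWithinAt.mono fun v hv => hv.1)
        (fun u hu => (hd u hu.1).mono (Set.Ici_subset_Ici.2 hu.1)) t ⟨ht, le_rfl⟩
      simp only [hz0, add_zero, sub_self] at h2
      linarith
    have hs0 : 0 ≤ s - s₀ := sub_nonneg.2 hs
    have h1 := HasDerivWithinAt.scomp s (hsol.slow (s - s₀) hs0)
      ((hasDerivWithinAt_id s (Set.Ici s₀)).sub_const s₀)
      (fun u hu => sub_nonneg.2 hu)
    rw [hz _ hs0, one_smul, add_sub_cancel] at h1
    exact h1
  · have hsol' : IsSlowFastSolution f₁ f₃ ε (fun t => w (s₀ + t)) (fun t => (s₀ + t) / ε) := by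
      refine ⟨fun t ht => ?_, fun t ht => ?_⟩
      · have h1 := HasDerivWithinAt.scomp t (hw (s₀ + t) (Set.mem_Ici.2 (le_add_of_nonneg_right ht)))
          ((hasDerivWithinAt_id t (Set.Ici 0)).const_add s₀)
          (fun u hu => Set.mem_Ici.2 (le_add_of_nonneg_right hu))
        rw [one_smul] at h1
        exact h1
      · rw [hone]
        exact ((hasDerivWithinAt_id t (Set.Ici 0)).const_add s₀).div_const ε
    have h2 := hdecay _ _ hsol' (by simpa using hw0) (by simp) (s - s₀) (sub_nonneg.2 hs)
    simpa using h2

end SlowFast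

/-- The averaging criterion, with the averaged system scaled by an arbitrary real `ε > 0`. -/
theorem partiallyExpStable_of_averaged {n : ℕ} (T : ℝ) (hT : 0 < T)
    (f₁ : EuclideanSpace ℝ (Fin n) → ℝ → EuclideanSpace ℝ (Fin n))
    (f₃ : EuclideanSpace ℝ (Fin n) → ℝ → ℝ)
    (hf₁ : ContDiff ℝ 1 (fun p : EuclideanSpace ℝ (Fin n) × ℝ => f₁ p.1 p.2))
    (hf₃ : ContDiff ℝ 1 (fun p : EuclideanSpace ℝ (Fin n) × ℝ => f₃ p.1 p.2))
    (hper₁ : ∀ x z, f₁ x (z + T) = f₁ x z)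
    (hper₃ : ∀ x z, f₃ x (z + T) = f₃ x z)
    (hzero : ∀ z, f₁ 0 z = 0)
    (ϑ : ℝ) (hϑ : 0 < ϑ) (hlower : ∀ x z, ϑ ≤ f₃ x z)
    (hglobal : ∃ ε₀ > 0, ∀ ε, 0 < ε → ε < ε₀ → ∀ x₀ z₀,
      ∃ x z, IsSlowFastSolution f₁ f₃ ε x z ∧ x 0 = x₀ ∧ z 0 = z₀)
    (hav : ∃ ε > (0 : ℝ), UniformlyExpStable
      (fun _ w => ε • averagedField T (slowField f₁ f₃) w))
    (hbound : ∃ δ > 0, ∃ L > 0, ∀ x ∈ Metric.ball (0 : EuclideanSpace ℝ (Fin n)) δ, ∀ z,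
      ‖fderiv ℝ (fun x' => slowField f₁ f₃ x' z) x‖ ≤ L) :
    ∃ ε₁ > 0, ∀ ε, 0 < ε → ε < ε₁ →
      PartiallyExpStable f₁ f₃ ε ∧
      ((∀ x z, f₃ x z = 1) → UniformlyExpStable (fun t x => f₁ x (t / ε))) := by
  obtain ⟨ε₀, hε₀, hglobal⟩ := hglobal
  obtain ⟨δ, hδ, L, hL, hbound⟩ := hbound
  have hh := isLipschitzField_slowField hf₁ hf₃ hzero
    (fun x z => (hϑ.trans_le (hlower x z)).ne') hL hbound
  have hper : ∀ x z, slowField f₁ f₃ x (z + T) = slowField f₁ f₃ x z := fun x z => by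
    rw [slowField, slowField, hper₁, hper₃]
  obtain ⟨ε₁, hε₁, ρ, hρ, M, hM, hdecay⟩ := exists_exp_decay hT hδ hh hper hav
  refine ⟨min ε₀ ε₁, lt_min hε₀ hε₁, fun ε hε hlt => ?_⟩
  obtain ⟨μ, hμ, hdecay⟩ := hdecay ε hε (hlt.trans_le (min_le_right _ _))
  have hpart : PartiallyExpStable f₁ f₃ ε := by
    refine ⟨M, hM, μ * (ϑ / ε), by positivity, ρ, hρ, fun x₀ z₀ hx₀ =>
      ⟨hglobal ε hε (hlt.trans_le (min_le_left _ _)) x₀ z₀, fun x z hsol hx0 _ t ht => ?_⟩⟩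
    have H := hsol.isReparametrizedSolution hε hϑ hlower
    have h1 := hdecay _ _ x z H (by rwa [hx0]) t ht
    have h2 := H.mul_sub_le le_rfl ht
    rw [hx0] at h1
    refine h1.trans (mul_le_mul_of_nonneg_left (Real.exp_le_exp.2 ?_) (by positivity))
    nlinarith
  exact ⟨hpart, hpart.uniformlyExpStable⟩

theorem corollary1 {n : ℕ} (T : ℝ) (hT : 0 < T)
    (f₁ : EuclideanSpace ℝ (Fin n) → ℝ → EuclideanSpace ℝ (Fin n))
    (f₃ : EuclideanSpace ℝ (Fin n) → ℝ → ℝ)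
    (hf₁ : ContDiff ℝ 1 (fun p : EuclideanSpace ℝ (Fin n) × ℝ => f₁ p.1 p.2))
    (hf₃ : ContDiff ℝ 1 (fun p : EuclideanSpace ℝ (Fin n) × ℝ => f₃ p.1 p.2))
    (hper₁ : ∀ x z, f₁ x (z + T) = f₁ x z)
    (hper₃ : ∀ x z, f₃ x (z + T) = f₃ x z)
    (hzero : ∀ z, f₁ 0 z = 0)
    (ϑ : ℝ) (hϑ : 0 < ϑ) (hlower : ∀ x z, ϑ ≤ f₃ x z)
    -- for small `ε`, all solutions of the slow-fast system exist for all `t ≥ 0`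
    (hglobal : ∃ ε₀ > 0, ∀ ε, 0 < ε → ε < ε₀ → ∀ x₀ z₀,
      ∃ x z, IsSlowFastSolution f₁ f₃ ε x z ∧ x 0 = x₀ ∧ z 0 = z₀)
    -- the autonomous system `dw/dz = ε ĥ_av(w)` is exponentially stable;
    -- rescaling `z` shows that this does not depend on the choice of `ε > 0`
    (hav : ∃ ε > 0, UniformlyExpStable
      (fun _ w => ε • averagedField T (slowField f₁ f₃) w))
    (hbound : ∃ δ > 0, ∃ L > 0, ∀ x ∈ Metric.ball (0 : EuclideanSpace ℝ (Fin n)) δ, ∀ z,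
      ‖fderiv ℝ (fun x' => slowField f₁ f₃ x' z) x‖ ≤ L) :
    ∃ ε₁ > 0, ∀ ε, 0 < ε → ε < ε₁ →
      PartiallyExpStable f₁ f₃ ε ∧
      -- classical averaging: `ẋ = f₁(x, t/ε)` when `f₃ ≡ 1`
      ((∀ x z, f₃ x z = 1) → UniformlyExpStable (fun t x => f₁ x (t / ε))) := by
  -- Nothing fixes the type of `ε` in `hav`, so it elaborates to a natural number, hence the cast.
  -- By time rescaling this is equivalent to a real `ε > 0`.
  obtain ⟨m, hm, hstab⟩ := hav
  refine partiallyExpStable_of_averaged T hT f₁ f₃ hf₁ hf₃ hper₁ hper₃ hzero ϑ hϑ hlower hglobal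
    ⟨(m : ℝ), Nat.cast_pos.2 hm, ?_⟩ hbound
  simpa only [Nat.cast_smul_eq_nsmul] using hstab
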